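/- Let $\mathcal A$ be a finite alphabet with $n=\#\mathcal A$ letters. A pair on $\mathcal A$ is $\mathbf p=(p_0,p_1)$ with bijections $p_0,p_1:\mathcal A\to\{1,\dots,n\}$; we write it as two rows, row $\varepsilon$ being the word $p_\varepsilon^{-1}(1)\,p_\varepsilon^{-1}(2)\cdots p_\varepsilon^{-1}(n)$. The pair is irreducible if, for $1\le k\le n$, $p_0^{-1}\{1,\dots,k\}=p_1^{-1}\{1,\dots,k\}$ holds if and only if $k=n$. An irreducible pair is standard if the first letter of each row is the last letter of the other row. For $\varepsilon\in\{0,1\}$, the Rauzy move of type $\varepsilon$ sends an irreducible $\mathbf p$ to the pair $\mathbf p'$ with $p'_\varepsilon=p_\varepsilon$ and, with $z=p_\varepsilon^{-1}(n)$, $$p'_{1-\varepsilon}(b)=\begin{cases}p_{1-\varepsilon}(b), & p_{1-\varepsilon}(b)\le p_{1-\varepsilon}(z),\\ p_{1-\varepsilon}(b)+1, & p_{1-\varepsilon}(z)<p_{1-\varepsilon}(b)<n,\\ p_{1-\varepsilon}(z)+1, & p_{1-\varepsilon}(z)<p_{1-\varepsilon}(b)=n.\end{cases}$$ The left Rauzy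 move of type $\varepsilon$ sends $\mathbf p$ to $\mathbf p'$ with $p'_\varepsilon=p_\varepsilon$ and, with $a=p_\varepsilon^{-1}(1)$, $$p'_{1-\varepsilon}(b)=\begin{cases}p_{1-\varepsilon}(b), & p_{1-\varepsilon}(b)\ge p_{1-\varepsilon}(a),\\ p_{1-\varepsilon}(b)-1, & 1<p_{1-\varepsilon}(b)<p_{1-\varepsilon}(a),\\ p_{1-\varepsilon}(a)-1, & 1=p_{1-\varepsilon}(b)<p_{1-\varepsilon}(a).\end{cases}$$ The labeled Extended Rauzy Class of an irreducible pair $\mathbf p$ is its class under the smallest equivalence relation on irreducible pairs that relates each irreducible pair to its images under the Rauzy moves and left Rauzy moves of both types. Switch moves act on standard pairs as follows, where the $w_i$ are possibly empty words. If $b,c$ are letters that are neither first nor last in any row, and $b$ precedes $c$ in both rows, the $\{b,c\}$-inner switch is $$\begin{pmatrix}a\;w_1\;b\;w_2\;c\;w_3\;z\\ z\;w_4\;b\;w_5\;c\;w_6\;a\end{pmatrix}\longmapsto\begin{pmatrix}a\;w_2\;c\;w_1\;b\;w_3\;z\\ z\;w_5\;c\;w_4\;b\;w_6\;a\end{pmatrix}.$$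 If $b$ is a letter that is neither first nor last in any row, the $\{a,b\}$- and $\{b,z\}$-outer switches are respectively $$\begin{pmatrix}a\;w_1\;b\;w_2\;z\\ z\;w_3\;b\;w_4\;a\end{pmatrix}\longmapsto\begin{pmatrix}b\;w_2\;a\;w_1\;z\\ z\;w_4\;a\;w_3\;b\end{pmatrix},\qquad \begin{pmatrix}a\;w_1\;b\;w_2\;z\\ z\;w_3\;b\;w_4\;a\end{pmatrix}\longmapsto\begin{pmatrix}a\;w_2\;z\;w_1\;b\\ b\;w_4\;z\;w_3\;a\end{pmatrix}.$$ Proposition. Let $\mathbf p$ and $\mathbf r$ be distinct standard pairs on $\mathcal A$. Then $\mathbf p$ and $\mathbf r$ are in the same labeled Extended Rauzy Class if and only if there is a finite sequence of inner and/or outer switch moves that leads from $\mathbf p$ to $\mathbf r$. -/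

import Mathlib

/-- A pair `p = (p₀, p₁)` on the finite alphabet `A`: two bijections from `A` onto the positions.
`Fin (Fintype.card A)` is used for the set of positions; see `RauzyPair.pos` for the positions
counted from `1`. -/
abbrev RauzyPair (A : Type*) [Fintype A] : Type _ :=
  Fin 2 → (A ≃ Fin (Fintype.card A))

namespace RauzyPair

variable {A : Type*} [Fintype A]

/-- The position `p_ε(b) ∈ {1, …, #A}` of the letter `b` in row `ε`. -/
def pos (p : RauzyPair A) (ε : Fin 2) (b : A) : ℕ := (p ε b : ℕ) + 1

/-- Row `ε` of `p`, written as a word: `p_ε⁻¹(1), p_ε⁻¹(2), …, p_ε⁻¹(#A)`. -/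
def row (p : RauzyPair A) (ε : Fin 2) : List A := List.ofFn fun i => (p ε).symm i

/-- `p` is irreducible: for `1 ≤ k ≤ #A`, the sets of the first `k` letters of the two rows agree
if and only if `k = #A`. -/
def IsIrreducible (p : RauzyPair A) : Prop :=
  ∀ k : ℕ, 1 ≤ k → k ≤ Fintype.card A →
    ({b : A | p.pos 0 b ≤ k} = {b : A | p.pos 1 b ≤ k} ↔ k = Fintype.card A)

/-- `p` is standard: it is irreducible, and the first letter of each row is the last letter of the
other row. -/
def IsStandard (p : RauzyPair A) : Prop :=
  p.IsIrreducible ∧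
    ∀ b : A, (p.pos 0 b = 1 ↔ p.pos 1 b = Fintype.card A) ∧
      (p.pos 1 b = 1 ↔ p.pos 0 b = Fintype.card A)

/-- `q = ε p`: the pair `q` is the image of `p` under the (right) Rauzy move of type `ε`. Here `z`
is the last letter of row `ε` of `p`, and in `Fin 2` the index `1 - ε` is the other row. -/
def RauzyMove (ε : Fin 2) (p q : RauzyPair A) : Prop :=
  q ε = p ε ∧
    ∀ z : A, p.pos ε z = Fintype.card A → ∀ b : A,
      q.pos (1 - ε) b =
        if p.pos (1 - ε) b ≤ p.pos (1 - ε) z then p.pos (1 - ε) b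
        else if p.pos (1 - ε) b < Fintype.card A then p.pos (1 - ε) b + 1
        else p.pos (1 - ε) z + 1

/-- `q = ε̃ p`: the pair `q` is the image of `p` under the left Rauzy move of type `ε`. Here `a` is
the first letter of row `ε` of `p`. -/
def LeftRauzyMove (ε : Fin 2) (p q : RauzyPair A) : Prop :=
  q ε = p ε ∧
    ∀ a : A, p.pos ε a = 1 → ∀ b : A,
      q.pos (1 - ε) b =
        if p.pos (1 - ε) a ≤ p.pos (1 - ε) b then p.pos (1 - ε) b
        else if p.pos (1 - ε) b = 1 then p.pos (1 - ε) a - 1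
        else p.pos (1 - ε) b - 1

/-- `q` is obtained from the irreducible pair `p` by one Rauzy move or left Rauzy move. -/
def ExtendedRauzyStep (p q : RauzyPair A) : Prop :=
  p.IsIrreducible ∧ q.IsIrreducible ∧ ∃ ε : Fin 2, RauzyMove ε p q ∨ LeftRauzyMove ε p q

/-- The labeled extended Rauzy class of the irreducible pair `p`: the class of `p` for the smallest
equivalence relation that relates every irreducible pair to its images under the Rauzy moves and
the left Rauzy moves of both types. -/
def extendedRauzyClass (p : RauzyPair A) : Set (RauzyPair A) :=
  {q | Relation.EqvGen ExtendedRauzyStep p q}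

/-- `q` is the result of the `{b, c}`-inner switch on the standard pair `p`, where `b` precedes `c`
in both rows and both letters are interior in both rows. -/
def InnerSwitch (b c : A) (p q : RauzyPair A) : Prop :=
  p.IsStandard ∧
    ∃ (a z : A) (w₁ w₂ w₃ w₄ w₅ w₆ : List A),
      p.row 0 = [a] ++ w₁ ++ [b] ++ w₂ ++ [c] ++ w₃ ++ [z] ∧
      p.row 1 = [z] ++ w₄ ++ [b] ++ w₅ ++ [c] ++ w₆ ++ [a] ∧
      q.row 0 = [a] ++ w₂ ++ [c] ++ w₁ ++ [b] ++ w₃ ++ [z] ∧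
      q.row 1 = [z] ++ w₅ ++ [c] ++ w₄ ++ [b] ++ w₆ ++ [a]

/-- `q` is the result of the `{a, b}`-outer switch on the standard pair `p`, where `a` is the first
letter of the top row (row `0`) of `p`. -/
def OuterSwitchFirst (a b : A) (p q : RauzyPair A) : Prop :=
  p.IsStandard ∧
    ∃ (z : A) (w₁ w₂ w₃ w₄ : List A),
      p.row 0 = [a] ++ w₁ ++ [b] ++ w₂ ++ [z] ∧
      p.row 1 = [z] ++ w₃ ++ [b] ++ w₄ ++ [a] ∧
      q.row 0 = [b] ++ w₂ ++ [a] ++ w₁ ++ [z] ∧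
      q.row 1 = [z] ++ w₄ ++ [a] ++ w₃ ++ [b]

/-- `q` is the result of the `{b, z}`-outer switch on the standard pair `p`, where `z` is the last
letter of the top row (row `0`) of `p`. -/
def OuterSwitchLast (b z : A) (p q : RauzyPair A) : Prop :=
  p.IsStandard ∧
    ∃ (a : A) (w₁ w₂ w₃ w₄ : List A),
      p.row 0 = [a] ++ w₁ ++ [b] ++ w₂ ++ [z] ∧
      p.row 1 = [z] ++ w₃ ++ [b] ++ w₄ ++ [a] ∧
      q.row 0 = [a] ++ w₂ ++ [z] ++ w₁ ++ [b] ∧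
      q.row 1 = [b] ++ w₄ ++ [z] ++ w₃ ++ [a]

/-- `q` is the result of an inner or outer switch move on `p`. -/
def SwitchMove (p q : RauzyPair A) : Prop :=
  ∃ b c : A, InnerSwitch b c p q ∨ OuterSwitchFirst b c p q ∨ OuterSwitchLast b c p q

end RauzyPair

/-! From switches to Rauzy moves, the reason is direct: repeated moves of one type rotate a segment
of one row. An inner switch is a product of four right rotations, and an outer switch is a product
of one left and one right rotation (`SwitchMove.eqvGen`).

The converse rests on an invariant. Write the rows as `A y W x` and `B x V y`. Rotating the part of
the lower row behind `x` until a common letter of `A` and `V` comes last shortens `A`;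
symmetrically, a common letter of `B` and `W` serves to shorten `B`. Irreducibility provides such a
letter as long as `A` and `B` are not both empty (`Good.exists_desc`), so every irreducible pair
descends to standard pairs. The set `F` collects these, up to switches.

The choice of descents does not matter. Two descents of one type are comparable, and two of opposite
types can be continued to tableaux that differ by an exchange of two blocks (`Desc.coherent`). Such
an exchange can be pushed down along descents (`BlockSwitch.coherent`) until it is an inner switch
of a standard pair. A simultaneous induction on `depth` (`coherent_of_depth_lt`) makes `F` invariant
under both operations. It is then invariant under single right and left moves (`RightMove.F_eq`,
`LeftMove.F_eq`), hence constant on extended Rauzy classes; on a standard pair it is the switch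
class. -/

/-- The two rows `A y W x` and `B x V y` of a pair whose last letters are `x` and `y`. -/
structure RauzyTab (α : Type*) where
  A : List α
  y : α
  W : List α
  x : α
  B : List α
  V : List α

namespace RauzyTab

open Relation

variable {α : Type*}

/-- The upper row. -/
def top (t : RauzyTab α) : List α := t.A ++ t.y :: (t.W ++ [t.x])

/-- The lower row. -/
def bot (t : RauzyTab α) : List α := t.B ++ t.x :: (t.V ++ [t.y])

/-- The tableau with the two rows interchanged. -/
def swap (t : RauzyTab α) : RauzyTab α := ⟨t.B, t.x, t.V, t.y, t.A, t.W⟩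

@[simp] theorem swap_swap (t : RauzyTab α) : t.swap.swap = t := rfl

/-- Both rows are arrangements of the same letters, and no proper nonempty initial segments of the
rows have the same letters. -/
structure Good (t : RauzyTab α) : Prop where
  nodup : t.top.Nodup
  perm : t.top.Perm t.bot
  irr : ∀ k, 0 < k → k ≤ t.A.length → k ≤ t.B.length → ¬ (t.A.take k).Perm (t.B.take k)

/-- The rows of a standard pair. -/
def Std (t : RauzyTab α) : Prop := t.A = [] ∧ t.B = []

/-- A rotation by Rauzy moves of one type that moves the last letter of the rotated row to the left
in the other row. -/
inductive Desc : RauzyTab α → RauzyTab α → Prop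
  | zero (A₁ A₂ W B V₁ V₂ : List α) (u y x : α) :
      Desc ⟨A₁ ++ u :: A₂, y, W, x, B, V₁ ++ u :: V₂⟩ ⟨A₁, u, A₂ ++ y :: W, x, B, V₂ ++ y :: V₁⟩
  | one (A W₁ W₂ B₁ B₂ V : List α) (u y x : α) :
      Desc ⟨A, y, W₁ ++ u :: W₂, x, B₁ ++ u :: B₂, V⟩ ⟨A, y, W₂ ++ x :: W₁, u, B₁, B₂ ++ x :: V⟩

/-- Switch moves on the rows of standard pairs. -/
inductive Switch : RauzyTab α → RauzyTab α → Prop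
  | inner (W₁ W₂ W₃ W₄ W₅ W₆ : List α) (a b c z : α) :
      Switch ⟨[], a, W₁ ++ b :: (W₂ ++ c :: W₃), z, [], W₄ ++ b :: (W₅ ++ c :: W₆)⟩
        ⟨[], a, W₂ ++ c :: (W₁ ++ b :: W₃), z, [], W₅ ++ c :: (W₄ ++ b :: W₆)⟩
  | first (W₁ W₂ W₃ W₄ : List α) (a b z : α) :
      Switch ⟨[], a, W₁ ++ b :: W₂, z, [], W₃ ++ b :: W₄⟩
        ⟨[], b, W₂ ++ a :: W₁, z, [], W₄ ++ a :: W₃⟩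
  | last (W₁ W₂ W₃ W₄ : List α) (a b z : α) :
      Switch ⟨[], a, W₁ ++ b :: W₂, z, [], W₃ ++ b :: W₄⟩
        ⟨[], a, W₂ ++ z :: W₁, b, [], W₄ ++ z :: W₃⟩

/-- The exchange of two blocks in both rows, with arbitrary initial segments `A` and `B`. -/
inductive BlockSwitch : RauzyTab α → RauzyTab α → Prop
  | mk (A B W₁ W₂ W₃ W₄ W₅ W₆ : List α) (y b c x : α) :
      BlockSwitch ⟨A, y, W₁ ++ b :: (W₂ ++ c :: W₃), x, B, W₄ ++ b :: (W₅ ++ c :: W₆)⟩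
        ⟨A, y, W₂ ++ c :: (W₁ ++ b :: W₃), x, B, W₅ ++ c :: (W₄ ++ b :: W₆)⟩

/-! ### Row symmetry, and existence of descents -/

theorem Desc.swap {t q : RauzyTab α} (h : Desc t q) : Desc t.swap q.swap := by
  cases h with
  | zero => exact Desc.one ..
  | one => exact Desc.zero ..

theorem Switch.swap {t q : RauzyTab α} (h : Switch t q) : Switch t.swap q.swap := by
  cases h with
  | inner => exact Switch.inner ..
  | first => exact Switch.last ..
  | last => exact Switch.first ..

theorem Switch.symm {t q : RauzyTab α} (h : Switch t q) : Switch q t := by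
  cases h with
  | inner => exact Switch.inner ..
  | first => exact Switch.first ..
  | last => exact Switch.last ..

theorem BlockSwitch.swap {t q : RauzyTab α} (h : BlockSwitch t q) :
    BlockSwitch t.swap q.swap := by
  cases h; exact BlockSwitch.mk ..

theorem BlockSwitch.symm {t q : RauzyTab α} (h : BlockSwitch t q) : BlockSwitch q t := by
  cases h; exact BlockSwitch.mk ..

theorem Good.swap {t : RauzyTab α} (h : Good t) : Good t.swap :=
  ⟨h.perm.nodup_iff.1 h.nodup, h.perm.symm, fun k h0 h1 h2 hp => h.irr k h0 h2 h1 hp.symm⟩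

theorem Std.swap {t : RauzyTab α} (h : Std t) : Std t.swap := ⟨h.2, h.1⟩

theorem Good.nodup_bot {t : RauzyTab α} (h : Good t) : t.bot.Nodup := h.swap.nodup

/-- Irreducibility only concerns prefixes inside `A` and `B`: a longer proper prefix contains `y` in
the upper row only, or `x` in the lower row only. A descent merely truncates `A` or `B`. -/
theorem Desc.good {t q : RauzyTab α} (h : Desc t q) (ht : Good t) : Good q := by
  classical
  have key : ∀ {t q : RauzyTab α}, Desc t q → Good t → q.top.Perm t.top ∧ q.bot.Perm t.bot := by
    intro t q h ht
    cases h <;> constructor <;> simp only [top, bot, List.perm_iff_count, List.count_append,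
      List.count_cons, List.count_nil] <;> intro a <;> omega
  obtain ⟨h1, h2⟩ := key h ht
  refine ⟨h1.nodup_iff.2 ht.nodup, h1.trans (ht.perm.trans h2.symm), ?_⟩
  intro k h0 hA hB hp
  cases h with
  | zero A₁ A₂ W B V₁ V₂ u y x =>
    refine ht.irr k h0 (by simp at hA ⊢; omega) hB ?_
    simpa [List.take_append_of_le_length hA] using hp
  | one A W₁ W₂ B₁ B₂ V u y x =>
    refine ht.irr k h0 hA (by simp at hB ⊢; omega) ?_
    simpa [List.take_append_of_le_length hB] using hp

theorem BlockSwitch.good {t q : RauzyTab α} (h : BlockSwitch t q) (ht : Good t) : Good q := by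
  classical
  have key : q.top.Perm t.top ∧ q.bot.Perm t.bot := by
    cases h; constructor <;> simp only [top, bot, List.perm_iff_count, List.count_append,
      List.count_cons, List.count_nil] <;> intro a <;> omega
  obtain ⟨h1, h2⟩ := key
  refine ⟨h1.nodup_iff.2 ht.nodup, h1.trans (ht.perm.trans h2.symm), ?_⟩
  cases h
  exact ht.irr

theorem Desc.exists_mem {t q : RauzyTab α} (h : Desc t q) :
    (∃ u, u ∈ t.A ∧ u ∈ t.V) ∨ ∃ u, u ∈ t.B ∧ u ∈ t.W := by
  cases h with
  | zero A₁ A₂ W B V₁ V₂ u y x => exact .inl ⟨u, by simp⟩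
  | one A W₁ W₂ B₁ B₂ V u y x => exact .inr ⟨u, by simp⟩

/-- If no letter lies in both `A` and `V`, or in both `B` and `W`, then `A` and `B` have the same
letters. Irreducibility forces them to be empty. -/
theorem Good.exists_desc {t : RauzyTab α} (ht : Good t) (hs : ¬ Std t) : ∃ q, Desc t q := by
  by_contra! hq
  obtain ⟨A, y, W, x, B, V⟩ := t
  have h1 : ∀ a ∈ A, a ∉ V := by
    intro a ha hv
    obtain ⟨A₁, A₂, rfl⟩ := List.append_of_mem ha
    obtain ⟨V₁, V₂, rfl⟩ := List.append_of_mem hv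
    exact hq _ (Desc.zero ..)
  have h2 : ∀ a ∈ B, a ∉ W := by
    intro a ha hv
    obtain ⟨A₁, A₂, rfl⟩ := List.append_of_mem ha
    obtain ⟨V₁, V₂, rfl⟩ := List.append_of_mem hv
    exact hq _ (Desc.one ..)
  have n1 := ht.nodup
  have n2 := ht.nodup_bot
  have hm : ∀ a, a ∈ A ++ y :: (W ++ [x]) ↔ a ∈ B ++ x :: (V ++ [y]) := fun a => ht.perm.mem_iff
  simp only [top, bot] at n1 n2
  have hAB : A.Perm B := by
    simp only [List.nodup_append, List.nodup_cons, List.mem_append, List.mem_cons,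
      List.not_mem_nil, or_false] at n1 n2 hm
    rw [List.perm_ext_iff_of_nodup n1.1 n2.1]
    intro a
    have := hm a
    have := h1 a
    have := h2 a
    have := n1.2.2 a
    have := n2.2.2 a
    grind
  have hl := hAB.length_eq
  refine ht.irr A.length ?_ le_rfl hl.le (by rw [List.take_length, hl, List.take_length]; exact hAB)
  rcases A with _ | ⟨a, A⟩
  · exact absurd ⟨rfl, List.length_eq_zero_iff.1 hl.symm⟩ hs
  · simp

/-! ### Standard tableaux below a given one -/

/-- The standard tableaux, up to switch moves, to which `t` descends. -/
def F (t : RauzyTab α) : Set (RauzyTab α) :=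
  {s | ∃ s₀, ReflTransGen Desc t s₀ ∧ Std s₀ ∧ ReflTransGen Switch s₀ s}

theorem Std.not_desc {t q : RauzyTab α} (h : Std t) : ¬ Desc t q := by
  rintro (_ | _) <;> simp [Std] at h

theorem Std.mem_F {t s : RauzyTab α} (h : Std t) : s ∈ F t ↔ ReflTransGen Switch t s := by
  constructor
  · rintro ⟨s₀, h1, -, h3⟩
    rcases ReflTransGen.cases_head h1 with rfl | ⟨q, hq, -⟩
    · exact h3
    · exact absurd hq h.not_desc
  · exact fun hs => ⟨t, .refl, h, hs⟩

theorem mem_F_of_not_std {t s : RauzyTab α} (h : ¬ Std t) : s ∈ F t ↔ ∃ q, Desc t q ∧ s ∈ F q := by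
  constructor
  · rintro ⟨s₀, h1, h2, h3⟩
    rcases ReflTransGen.cases_head h1 with rfl | ⟨q, hq, h4⟩
    · exact absurd h2 h
    · exact ⟨q, hq, s₀, h4, h2, h3⟩
  · rintro ⟨q, hq, s₀, h1, h2, h3⟩
    exact ⟨s₀, .head hq h1, h2, h3⟩

theorem mem_F_swap {t s : RauzyTab α} : s ∈ F t.swap ↔ s.swap ∈ F t := by
  have key : ∀ {t s : RauzyTab α}, s ∈ F t → s.swap ∈ F t.swap := by
    rintro t s ⟨s₀, h1, h2, h3⟩
    exact ⟨s₀.swap, h1.lift _ fun _ _ h => h.swap, h2.swap, h3.lift _ fun _ _ h => h.swap⟩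
  exact ⟨fun h => by simpa using key h, fun h => by simpa using key h⟩

theorem F_swap_inj {t q : RauzyTab α} : F t.swap = F q.swap ↔ F t = F q := by
  constructor
  · intro h; ext s
    have := congrArg (s.swap ∈ ·) h
    simpa [mem_F_swap] using this
  · intro h; ext s
    rw [mem_F_swap, mem_F_swap, h]

theorem Switch.F_eq {t q : RauzyTab α} (h : Switch t q) : F t = F q := by
  have ht : Std t := by cases h <;> exact ⟨rfl, rfl⟩
  have hq : Std q := by cases h <;> exact ⟨rfl, rfl⟩
  ext s
  rw [ht.mem_F, hq.mem_F]
  exact ⟨fun hs => .head h.symm hs, fun hs => .head h hs⟩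

/-! ### Confluence of descents up to switches -/

/-- The measure of the distance from being standard. -/
def depth (t : RauzyTab α) : ℕ := t.A.length + t.B.length

theorem depth_swap (t : RauzyTab α) : t.swap.depth = t.depth := Nat.add_comm ..

theorem Desc.depth_lt {t q : RauzyTab α} (h : Desc t q) : q.depth < t.depth := by
  cases h <;> simp [depth]

/-- Below depth `k`, the set `F` is invariant under descents and block switches. -/
def Coherent (α : Type*) (k : ℕ) : Prop :=
  (∀ t q : RauzyTab α, Good t → t.depth < k → Desc t q → F t = F q) ∧
    ∀ t q : RauzyTab α, Good t → t.depth < k → BlockSwitch t q → F t = F q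

theorem nodup_split_unique {A₁ A₂ B₁ B₂ : List α} {u : α} (h : A₁ ++ u :: A₂ = B₁ ++ u :: B₂)
    (hn : (A₁ ++ u :: A₂).Nodup) : A₁ = B₁ ∧ A₂ = B₂ := by
  induction A₁ generalizing B₁ with
  | nil => cases B₁ <;> simp at h hn ⊢ <;> grind
  | cons a A₁ ih =>
    cases B₁ with
    | nil => simp at h hn; grind
    | cons b B₁ =>
      simp only [List.cons_append, List.cons.injEq] at h
      obtain ⟨rfl, h⟩ := h
      obtain ⟨rfl, rfl⟩ := ih h (List.nodup_cons.1 hn).2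
      exact ⟨rfl, rfl⟩

/-- All descents of this type rotate the same cyclic word `V y`. Bringing `u` to the end and then
`v` is therefore the same as bringing `v` to the end at once. -/
theorem desc_of_split {P Q A₂ V₁ V₂ V₁' V₂' W B : List α} {u v y x : α} (huv : u ≠ v)
    (hV : V₁ ++ u :: V₂ = V₁' ++ v :: V₂') :
    Desc ⟨P ++ v :: Q, u, A₂ ++ y :: W, x, B, V₂ ++ y :: V₁⟩
      ⟨P, v, (Q ++ u :: A₂) ++ y :: W, x, B, V₂' ++ y :: V₁'⟩ := by
  rcases List.append_eq_append_iff.1 hV with ⟨R, rfl, h⟩ | ⟨R, rfl, h⟩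
  · rcases R with _ | ⟨r, R⟩
    · simp_all
    · obtain ⟨rfl, rfl⟩ : u = r ∧ V₂ = R ++ v :: V₂' := by simpa using h
      simpa using Desc.zero P Q (A₂ ++ y :: W) B R (V₂' ++ y :: V₁) v u x
  · rcases R with _ | ⟨r, R⟩
    · simp_all
    · obtain ⟨rfl, rfl⟩ : v = r ∧ V₂' = R ++ u :: V₂ := by simpa using h
      simpa using Desc.zero P Q (A₂ ++ y :: W) B (V₂ ++ y :: V₁') R v u x

/-- Local confluence. For equal types, the descent whose letter is further right in `A` (or in `B`)
can be continued to the other one. For opposite types, performing the other descent second gives two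
results related by a block switch. -/
theorem Desc.coherent {k : ℕ} (hk : Coherent α k) {t q r : RauzyTab α} (ht : Good t)
    (hd : t.depth = k) (hq : Desc t q) (hr : Desc t r) : F q = F r := by
  have zz : ∀ {A₁ A₂ A₁' A₂' V₁ V₂ V₁' V₂' W B : List α} {u v y x : α},
      Good ⟨A₁ ++ u :: A₂, y, W, x, B, V₁ ++ u :: V₂⟩ →
      (⟨A₁ ++ u :: A₂, y, W, x, B, V₁ ++ u :: V₂⟩ : RauzyTab α).depth = k →
      A₁ ++ u :: A₂ = A₁' ++ v :: A₂' → V₁ ++ u :: V₂ = V₁' ++ v :: V₂' →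
      F ⟨A₁, u, A₂ ++ y :: W, x, B, V₂ ++ y :: V₁⟩ =
        F ⟨A₁', v, A₂' ++ y :: W, x, B, V₂' ++ y :: V₁'⟩ := by
    intro A₁ A₂ A₁' A₂' V₁ V₂ V₁' V₂' W B u v y x ht hd hA hV
    have d1 := Desc.zero A₁ A₂ W B V₁ V₂ u y x
    have d2 := Desc.zero A₁' A₂' W B V₁' V₂' v y x
    rw [← hA, ← hV] at d2
    have n1 : (A₁ ++ u :: A₂).Nodup := (List.nodup_append.1 ht.nodup).1
    have n2 : (V₁ ++ u :: V₂).Nodup :=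
      (List.nodup_append.1 (List.nodup_cons.1 (List.nodup_append.1 ht.nodup_bot).2.1).2).1
    by_cases huv : u = v
    · subst huv
      obtain ⟨rfl, rfl⟩ := nodup_split_unique hA n1
      obtain ⟨rfl, rfl⟩ := nodup_split_unique hV n2
      rfl
    · rcases List.append_eq_append_iff.1 hA with ⟨R, rfl, h⟩ | ⟨R, rfl, h⟩
      · rcases R with _ | ⟨r, R⟩
        · simp_all
        · obtain ⟨rfl, rfl⟩ : u = r ∧ A₂ = R ++ v :: A₂' := by simpa using h
          exact (hk.1 _ _ (d2.good ht) (hd ▸ d2.depth_lt) (desc_of_split (Ne.symm huv) hV.symm)).symm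
      · rcases R with _ | ⟨r, R⟩
        · simp_all
        · obtain ⟨rfl, rfl⟩ : v = r ∧ A₂' = R ++ u :: A₂ := by simpa using h
          exact hk.1 _ _ (d1.good ht) (hd ▸ d1.depth_lt) (desc_of_split huv hV)
  have zo : ∀ {A₁ A₂ W₁ W₂ B₁ B₂ V₁ V₂ : List α} {u v y x : α},
      Good ⟨A₁ ++ u :: A₂, y, W₁ ++ v :: W₂, x, B₁ ++ v :: B₂, V₁ ++ u :: V₂⟩ →
      (⟨A₁ ++ u :: A₂, y, W₁ ++ v :: W₂, x, B₁ ++ v :: B₂, V₁ ++ u :: V₂⟩ : RauzyTab α).depth = k →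
      F ⟨A₁, u, A₂ ++ y :: (W₁ ++ v :: W₂), x, B₁ ++ v :: B₂, V₂ ++ y :: V₁⟩ =
        F ⟨A₁ ++ u :: A₂, y, W₂ ++ x :: W₁, v, B₁, B₂ ++ x :: (V₁ ++ u :: V₂)⟩ := by
    intro A₁ A₂ W₁ W₂ B₁ B₂ V₁ V₂ u v y x ht hd
    have d1 := Desc.zero A₁ A₂ (W₁ ++ v :: W₂) (B₁ ++ v :: B₂) V₁ V₂ u y x
    have d2 := Desc.one (A₁ ++ u :: A₂) W₁ W₂ B₁ B₂ (V₁ ++ u :: V₂) v y x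
    have e1 := Desc.one A₁ (A₂ ++ y :: W₁) W₂ B₁ B₂ (V₂ ++ y :: V₁) v u x
    have e2 := Desc.zero A₁ A₂ (W₂ ++ x :: W₁) B₁ (B₂ ++ x :: V₁) V₂ u y v
    simp only [List.append_assoc, List.cons_append] at e1 e2
    -- The two orders of rotation differ by exchanging `A₂ y` with `W₂ x` in the upper row and `V₂
    -- y` with `B₂ x` in the lower row.
    rw [hk.1 _ _ (d1.good ht) (hd ▸ d1.depth_lt) e1, hk.1 _ _ (d2.good ht) (hd ▸ d2.depth_lt) e2]
    refine hk.2 _ _ (e1.good (d1.good ht)) (hd ▸ e1.depth_lt.trans d1.depth_lt) ?_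
    exact BlockSwitch.mk ..
  cases hq with
  | zero A₁ A₂ W B V₁ V₂ u y x =>
    generalize hT : (⟨A₁ ++ u :: A₂, y, W, x, B, V₁ ++ u :: V₂⟩ : RauzyTab α) = T at hr
    cases hr with
    | zero =>
      simp only [mk.injEq] at hT
      obtain ⟨hA, rfl, rfl, rfl, rfl, hV⟩ := hT
      exact zz ht hd hA hV
    | one =>
      simp only [mk.injEq] at hT
      obtain ⟨rfl, rfl, rfl, rfl, rfl, rfl⟩ := hT
      exact zo ht hd
  | one A W₁ W₂ B₁ B₂ V u y x =>
    generalize hT : (⟨A, y, W₁ ++ u :: W₂, x, B₁ ++ u :: B₂, V⟩ : RauzyTab α) = T at hr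
    cases hr with
    | zero =>
      simp only [mk.injEq] at hT
      obtain ⟨rfl, rfl, rfl, rfl, rfl, rfl⟩ := hT
      exact (zo ht hd).symm
    | one =>
      simp only [mk.injEq] at hT
      obtain ⟨rfl, rfl, hW, rfl, hB, rfl⟩ := hT
      exact F_swap_inj.1 (zz ht.swap ((depth_swap _).trans hd) hB hW)

/-- At depth zero a block switch is an inner switch. Otherwise one letter `u` gives a descent on
both sides, and the results, of smaller depth, are joined by two block switches. -/
theorem BlockSwitch.coherent {k : ℕ} (hk : Coherent α k)
    (hk' : ∀ t q : RauzyTab α, Good t → t.depth = k → Desc t q → F t = F q)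
    {t r : RauzyTab α} (ht : Good t) (hd : t.depth = k) (hr : BlockSwitch t r) : F t = F r := by
  have key : ∀ {A B W₁ W₂ W₃ W₄ W₅ W₆ : List α} {u y b c x : α},
      Good ⟨A, y, W₁ ++ b :: (W₂ ++ c :: W₃), x, B, W₄ ++ b :: (W₅ ++ c :: W₆)⟩ →
      (⟨A, y, W₁ ++ b :: (W₂ ++ c :: W₃), x, B, W₄ ++ b :: (W₅ ++ c :: W₆)⟩ :
        RauzyTab α).depth = k → u ∈ A → (u ∈ W₄ ∨ u ∈ W₆) →
      F ⟨A, y, W₁ ++ b :: (W₂ ++ c :: W₃), x, B, W₄ ++ b :: (W₅ ++ c :: W₆)⟩ =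
      F ⟨A, y, W₂ ++ c :: (W₁ ++ b :: W₃), x, B, W₅ ++ c :: (W₄ ++ b :: W₆)⟩ := by
    intro A B W₁ W₂ W₃ W₄ W₅ W₆ u y b c x ht hd hA hu
    obtain ⟨A₁, A₂, rfl⟩ := List.append_of_mem hA
    have hg := (BlockSwitch.mk ..).good ht
    rcases hu with hu | hu <;> obtain ⟨C, D, rfl⟩ := List.append_of_mem hu
    -- After the descent, the blocks ending in `b` and `c` are exchanged first, then those ending in
    -- `c` and `y`.
    · have d1 := Desc.zero A₁ A₂ (W₁ ++ b :: (W₂ ++ c :: W₃)) B C (D ++ b :: (W₅ ++ c :: W₆)) u y x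
      have d2 := Desc.zero A₁ A₂ (W₂ ++ c :: (W₁ ++ b :: W₃)) B (W₅ ++ c :: C) (D ++ b :: W₆) u y x
      have g1 := BlockSwitch.mk A₁ B (A₂ ++ y :: W₁) W₂ W₃ D W₅ (W₆ ++ y :: C) u b c x
      have g2 := BlockSwitch.mk A₁ B W₂ A₂ (W₁ ++ b :: W₃) W₅ (D ++ b :: W₆) C u c y x
      simp only [List.append_assoc, List.cons_append] at d1 d2 g1 g2 ht hg hd ⊢
      rw [hk' _ _ ht hd d1, hk' _ _ hg hd d2,
        hk.2 _ _ (d1.good ht) (hd ▸ d1.depth_lt) g1,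
        hk.2 _ _ (g1.good (d1.good ht)) (hd ▸ d1.depth_lt) g2]
    · have d1 := Desc.zero A₁ A₂ (W₁ ++ b :: (W₂ ++ c :: W₃)) B (W₄ ++ b :: (W₅ ++ c :: C)) D u y x
      have d2 := Desc.zero A₁ A₂ (W₂ ++ c :: (W₁ ++ b :: W₃)) B (W₅ ++ c :: (W₄ ++ b :: C)) D u y x
      have g1 := BlockSwitch.mk A₁ B (A₂ ++ y :: W₁) W₂ W₃ (D ++ y :: W₄) W₅ C u b c x
      have g2 := BlockSwitch.mk A₁ B W₂ A₂ (W₁ ++ b :: W₃) W₅ D (W₄ ++ b :: C) u c y x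
      simp only [List.append_assoc, List.cons_append] at d1 d2 g1 g2 ht hg hd ⊢
      rw [hk' _ _ ht hd d1, hk' _ _ hg hd d2,
        hk.2 _ _ (d1.good ht) (hd ▸ d1.depth_lt) g1,
        hk.2 _ _ (g1.good (d1.good ht)) (hd ▸ d1.depth_lt) g2]
  have main : ∀ {A B W₁ W₂ W₃ W₄ W₅ W₆ : List α} {u y b c x : α},
      Good ⟨A, y, W₁ ++ b :: (W₂ ++ c :: W₃), x, B, W₄ ++ b :: (W₅ ++ c :: W₆)⟩ →
      (⟨A, y, W₁ ++ b :: (W₂ ++ c :: W₃), x, B, W₄ ++ b :: (W₅ ++ c :: W₆)⟩ :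
        RauzyTab α).depth = k → u ∈ A → u ∈ W₄ ++ b :: (W₅ ++ c :: W₆) →
      F ⟨A, y, W₁ ++ b :: (W₂ ++ c :: W₃), x, B, W₄ ++ b :: (W₅ ++ c :: W₆)⟩ =
      F ⟨A, y, W₂ ++ c :: (W₁ ++ b :: W₃), x, B, W₅ ++ c :: (W₄ ++ b :: W₆)⟩ := by
    intro A B W₁ W₂ W₃ W₄ W₅ W₆ u y b c x ht hd hA hu
    have hn := (List.nodup_append.1 ht.nodup).2.2 u hA
    have hub : u ≠ b := hn b (by simp)
    have huc : u ≠ c := hn c (by simp)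
    simp only [List.mem_append, List.mem_cons, hub, huc, false_or] at hu
    rcases hu with hu | hu | hu
    · exact key ht hd hA (.inl hu)
    -- For `u` in `W₅` the inverse switch is used, since there `W₅` takes the place of `W₄`.
    · exact (key ((BlockSwitch.mk ..).good ht) hd hA (.inl hu)).symm
    · exact key ht hd hA (.inr hu)
  by_cases hs : Std t
  · cases hr
    obtain ⟨rfl, rfl⟩ := hs
    exact (Switch.inner ..).F_eq
  · obtain ⟨q, hq⟩ := ht.exists_desc hs
    cases hr
    rcases hq.exists_mem with ⟨u, hu, hu'⟩ | ⟨u, hu, hu'⟩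
    · exact main ht hd hu hu'
    · exact F_swap_inj.1 (main ht.swap ((depth_swap _).trans hd) hu hu')

theorem coherent_of_depth_lt (k : ℕ) : Coherent α k := by
  induction k with
  | zero => exact ⟨fun _ _ _ h => absurd h (Nat.not_lt_zero _),
      fun _ _ _ h => absurd h (Nat.not_lt_zero _)⟩
  | succ k ih =>
    have h : ∀ t q : RauzyTab α, Good t → t.depth = k → Desc t q → F t = F q := by
      intro t q ht hd hq
      ext s
      rw [mem_F_of_not_std fun hs => hs.not_desc hq]
      constructor
      · rintro ⟨r, hr, hs⟩
        rwa [hq.coherent ih ht hd hr]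
      · exact fun hs => ⟨q, hq, hs⟩
    refine ⟨fun t q ht hd hq => ?_, fun t q ht hd hq => ?_⟩
    · rcases Nat.lt_succ_iff_lt_or_eq.1 hd with hd | hd
      · exact ih.1 t q ht hd hq
      · exact h t q ht hd hq
    · rcases Nat.lt_succ_iff_lt_or_eq.1 hd with hd | hd
      · exact ih.2 t q ht hd hq
      · exact hq.coherent ih h ht hd

theorem Desc.F_eq {t q : RauzyTab α} (h : Desc t q) (ht : Good t) : F t = F q :=
  (coherent_of_depth_lt (t.depth + 1)).1 t q ht (Nat.lt_succ_self _) h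

theorem Good.eq_of_rows {t q : RauzyTab α} (ht : Good t) (h0 : t.top = q.top)
    (h1 : t.bot = q.bot) : t = q := by
  obtain ⟨A, y, W, x, B, V⟩ := t
  obtain ⟨A', y', W', x', B', V'⟩ := q
  have n0 := ht.nodup
  have n1 := ht.nodup_bot
  simp only [top, bot] at h0 h1 n0 n1
  rw [← List.cons_append, ← List.append_assoc] at n0 n1
  rw [← List.cons_append, ← List.append_assoc, ← List.cons_append, ← List.append_assoc] at h0 h1
  obtain ⟨h2, hx⟩ := List.append_inj' h0 rfl
  obtain ⟨h3, hy⟩ := List.append_inj' h1 rfl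
  obtain rfl : x = x' := by simpa using hx
  obtain rfl : y = y' := by simpa using hy
  obtain ⟨rfl, rfl⟩ := nodup_split_unique h2 (List.nodup_append.1 n0).1
  obtain ⟨rfl, rfl⟩ := nodup_split_unique h3 (List.nodup_append.1 n1).1
  rfl

/-! ### Invariance of `F` under single right and left moves -/

/-- The rows of `q` arise from those of `t` by the right Rauzy move of type `0`. -/
def RightMove (t q : RauzyTab α) : Prop :=
  ∃ (C D U : List α) (x e : α), t.top = C ++ [x] ∧ q.top = t.top ∧
    t.bot = D ++ x :: (U ++ [e]) ∧ q.bot = D ++ x :: e :: U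

/-- The rows of `q` arise from those of `t` by the left Rauzy move of type `0`. -/
def LeftMove (t q : RauzyTab α) : Prop :=
  ∃ (C D U : List α) (a e : α), t.top = a :: C ∧ q.top = t.top ∧
    t.bot = e :: (U ++ a :: D) ∧ q.bot = U ++ e :: a :: D

/-- Unless it does nothing, a right move replaces the last letter `y` of the lower row by its
predecessor `v`. It is a descent if `v` is left of `y` in the upper row, and the inverse of a
descent otherwise. -/
theorem RightMove.F_eq {t q : RauzyTab α} (h : RightMove t q) (ht : Good t) (hq : Good q) :
    F t = F q := by
  obtain ⟨C, D, U, x, e, h1, h2, h3, h4⟩ := h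
  obtain ⟨A, y, W, x', B, V⟩ := t
  obtain rfl : x' = x := by
    simp only [top] at h1
    rw [← List.cons_append, ← List.append_assoc] at h1
    simpa using (List.append_inj' h1 rfl).2
  have hn := ht.nodup_bot
  obtain ⟨rfl, h5⟩ := nodup_split_unique h3 hn
  obtain ⟨rfl, h6⟩ := List.append_inj' h5 rfl
  obtain rfl : y = e := by simpa using h6
  rcases List.eq_nil_or_concat' V with rfl | ⟨V, v, rfl⟩
  · rw [ht.eq_of_rows h2.symm (h3.trans h4.symm)]
  have hv : v ∈ q.top := h2 ▸ ht.perm.mem_iff.2 (by simp [bot])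
  have hvx : v ≠ x' := by rintro rfl; simp [bot] at hn; grind
  have hvy : v ≠ y := by rintro rfl; simp [bot] at hn; grind
  rw [h2] at hv
  simp only [top, List.mem_append, List.mem_cons, hvx, hvy, List.not_mem_nil, or_false,
    false_or] at hv
  rcases hv with hv | hv <;> obtain ⟨P, Q, rfl⟩ := List.append_of_mem hv
  · have d := Desc.zero P Q W B V [] v y x'
    rw [d.F_eq ht, hq.eq_of_rows (q := ⟨P, v, Q ++ y :: W, x', B, [] ++ y :: V⟩)]
    · exact h2.trans (by simp [top])
    · exact h4.trans (by simp [bot])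
  · have d := Desc.zero A P Q B [] V y v x'
    obtain rfl := hq.eq_of_rows (q := ⟨A ++ y :: P, v, Q, x', B, [] ++ y :: V⟩)
      (h2.trans (by simp [top])) (h4.trans (by simp [bot]))
    rw [d.F_eq hq]

theorem Good.of_nil {y x : α} {W B V B' V' : List α} (ht : Good ⟨[], y, W, x, B, V⟩)
    (h : (B' ++ x :: V').Perm (B ++ x :: V)) : Good ⟨[], y, W, x, B', V'⟩ := by
  refine ⟨ht.nodup, ht.perm.trans ?_, fun k h0 h1 => absurd h1 (by simpa using h0.ne')⟩
  simpa [bot] using (h.symm.append_right [y])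

theorem Good.nodup_row {t : RauzyTab α} (ht : Good t) :
    (t.B ++ t.x :: t.V).Nodup ∧ t.y ∉ t.B ++ t.x :: t.V := by
  have h := ht.nodup_bot
  simp only [bot] at h
  rw [← List.cons_append, ← List.append_assoc] at h
  have h' := List.nodup_append.1 h
  exact ⟨h'.1, fun hy => h'.2.2 _ hy _ (by simp) rfl⟩

theorem Good.mem_of_nil {y x e : α} {W B V : List α} (ht : Good ⟨[], y, W, x, B, V⟩)
    (he : e ∈ B ∨ e ∈ V) : e ∈ W := by
  have h : e ∈ (⟨[], y, W, x, B, V⟩ : RauzyTab α).top :=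
    ht.perm.mem_iff.2 (by simp only [bot, List.mem_append, List.mem_cons]; tauto)
  obtain ⟨h1, h2⟩ := ht.nodup_row
  have hy : e ≠ y := by
    rintro rfl
    simp at h2
    tauto
  have hx : e ≠ x := by
    rintro rfl
    simp [List.nodup_append] at h1
    grind
  simpa [top, hx, hy] using h

/-- This is the left move when `A` is empty: the first letter of the lower row goes to just before
`y`. One descent at most makes each side standard, and the standard tableaux agree or differ by an
outer switch. -/
theorem F_eq_of_cons {y x e : α} {W B V B' V' U : List α} (ht : Good ⟨[], y, W, x, B, V⟩)
    (h : B ++ x :: V = e :: U) (h' : B' ++ x :: V' = U ++ [e]) :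
    F ⟨[], y, W, x, B, V⟩ = F ⟨[], y, W, x, B', V'⟩ := by
  have hq : Good ⟨[], y, W, x, B', V'⟩ := ht.of_nil (by
    rw [h, h']; exact List.perm_append_singleton ..)
  have hU : (U ++ [e]).Nodup := by
    rw [← h']
    exact hq.nodup_row.1
  rcases B with _ | ⟨e', B⟩
  · obtain ⟨rfl, rfl⟩ : x = e ∧ V = U := by simpa using h
    obtain ⟨rfl, rfl⟩ := nodup_split_unique h'.symm hU
    rcases V with _ | ⟨v, V⟩
    · rfl
    obtain ⟨W₁, W₂, rfl⟩ := List.append_of_mem (ht.mem_of_nil (e := v) (by simp))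
    exact (Switch.last W₁ W₂ [] V y v x).F_eq.trans
      ((Desc.one [] W₁ W₂ [] V [] v y x).F_eq hq).symm
  · obtain ⟨rfl, rfl⟩ : e' = e ∧ B ++ x :: V = U := by simpa using h
    simp only [List.append_assoc, List.cons_append] at h' hU
    obtain ⟨rfl, rfl⟩ := nodup_split_unique h'.symm hU
    obtain ⟨W₁, W₂, rfl⟩ := List.append_of_mem (ht.mem_of_nil (e := e') (by simp))
    have d := Desc.one [] W₁ W₂ [] B V e' y x
    rw [List.nil_append] at d
    rw [d.F_eq ht]
    rcases B with _ | ⟨v, B⟩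
    · exact (Switch.last W₁ W₂ V [] y e' x).F_eq.symm
    have hv := ht.mem_of_nil (e := v) (by simp)
    have hve : v ≠ e' := by
      rintro rfl
      simpa [bot] using ht.nodup_bot
    simp only [List.mem_append, List.mem_cons, hve, false_or] at hv
    -- The old tableau has descended by its first lower letter `e'`; the new one starts its lower
    -- row with `v` and descends by `v`. The outer switch at `v` connects the two. The cases only
    -- record the order of `v` and `e'` in the upper row.
    rcases hv with hv | hv <;> obtain ⟨P, Q, rfl⟩ := List.append_of_mem hv
    · have s := Switch.last (W₂ ++ x :: P) Q [] (B ++ x :: V) y v e'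
      have d' := Desc.one [] P (Q ++ e' :: W₂) [] B (V ++ [e']) v y x
      simp only [List.append_assoc, List.cons_append, List.nil_append] at s d' hq ⊢
      rw [s.F_eq, d'.F_eq hq]
    · have s := Switch.last P (Q ++ x :: W₁) [] (B ++ x :: V) y v e'
      have d' := Desc.one [] (W₁ ++ e' :: P) Q [] B (V ++ [e']) v y x
      simp only [List.append_assoc, List.cons_append, List.nil_append] at s d' hq ⊢
      rw [s.F_eq, d'.F_eq hq]

theorem F_eq_of_rotate {y x : α} {W C₁ C₂ B V B' V' : List α} (ht : Good ⟨[], y, W, x, B, V⟩)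
    (h : B ++ x :: V = C₁ ++ C₂) (h' : B' ++ x :: V' = C₂ ++ C₁) :
    F ⟨[], y, W, x, B, V⟩ = F ⟨[], y, W, x, B', V'⟩ := by
  induction C₁ generalizing B V C₂ with
  | nil =>
    obtain ⟨rfl, rfl⟩ := nodup_split_unique (h.trans (by simpa using h'.symm)) ht.nodup_row.1
    rfl
  | cons e C₁ ih =>
    obtain ⟨B₁, V₁, h₁⟩ : ∃ B₁ V₁, C₁ ++ C₂ ++ [e] = B₁ ++ x :: V₁ := by
      apply List.append_of_mem
      have : x ∈ B ++ x :: V := by simp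
      rw [h] at this
      simp at this ⊢
      tauto
    rw [F_eq_of_cons ht h h₁.symm]
    refine ih (ht.of_nil ?_) (C₂ := C₂ ++ [e]) (by simpa using h₁.symm) (by simpa using h')
    rw [h, ← h₁]
    exact (List.perm_append_singleton ..)

/-- Let `a` begin the upper row. If `A` is empty, `F_eq_of_cons` applies. If `a` lies in `V`,
descending by `a` empties `A`, and the left move becomes a rotation of the lower row before its last
letter. If `a` lies in `B`, the left move takes place before `x` and commutes with any descent, so
induction on `depth` applies. -/
theorem LeftMove.F_eq {t q : RauzyTab α} (h : LeftMove t q) (ht : Good t) (hq : Good q) :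
    F t = F q := by
  induction hn : t.depth using Nat.strong_induction_on generalizing t q with
  | _ n ih =>
  subst hn
  obtain ⟨C, D, U, a, e, h1, h2, h3, h4⟩ := h
  obtain ⟨A, y, W, x, B, V⟩ := t
  have hyx : y ≠ x := by
    have := ht.nodup_row.2
    simp at this
    tauto
  rcases A with _ | ⟨a', A⟩
  · obtain ⟨rfl, -⟩ : y = a ∧ _ := by simpa [top] using h1
    have h5 : (B ++ x :: V) ++ y :: [] = (e :: U) ++ y :: D := by simpa [bot] using h3
    obtain ⟨h6, rfl⟩ := nodup_split_unique h5 (by simpa [bot] using ht.nodup_bot)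
    obtain ⟨B', V', h7⟩ : ∃ B' V', U ++ [e] = B' ++ x :: V' := by
      apply List.append_of_mem
      have : x ∈ B ++ x :: V := by simp
      rw [h6] at this
      simp at this ⊢
      tauto
    rw [F_eq_of_cons ht h6 h7.symm, hq.eq_of_rows (q := ⟨[], y, W, x, B', V'⟩) h2]
    rw [h4, ← List.singleton_append, ← List.append_assoc, h7]
    simp [bot]
  obtain ⟨rfl, -⟩ : a' = a ∧ _ := by simpa [top] using h1
  have ha : a' ∈ (⟨a' :: A, y, W, x, B, V⟩ : RauzyTab α).bot := ht.perm.mem_iff.1 (by simp [top])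
  have hay : a' ≠ y := by
    rintro rfl
    simpa [top] using ht.nodup
  have hax : a' ≠ x := by
    rintro rfl
    simpa [top] using ht.nodup
  simp only [bot, List.mem_append, List.mem_cons, hay, hax, List.not_mem_nil, or_false,
    false_or] at ha
  rcases ha with ha | ha
  · obtain ⟨P, B₂, rfl⟩ := List.append_of_mem ha
    have h5 : P ++ a' :: (B₂ ++ x :: (V ++ [y])) = (e :: U) ++ a' :: D := by simpa [bot] using h3
    obtain ⟨rfl, rfl⟩ := nodup_split_unique h5 (by simpa [bot] using ht.nodup_bot)
    obtain rfl := hq.eq_of_rows (q := ⟨a' :: A, y, W, x, U ++ e :: a' :: B₂, V⟩) h2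
      (h4.trans (by simp [bot]))
    obtain ⟨r, hr⟩ := ht.exists_desc fun hs => by simpa using hs.1
    rcases hr.exists_mem with ⟨u, hA, hV⟩ | ⟨u, hB, hW⟩
    · have hua : u ≠ a' := by
        rintro rfl
        have := ht.nodup_row.1
        simp at this hV
        grind
      obtain ⟨A₁, A₂, rfl⟩ := List.append_of_mem ((List.mem_cons.1 hA).resolve_left hua)
      obtain ⟨V₁, V₂, rfl⟩ := List.append_of_mem hV
      have d := Desc.zero (a' :: A₁) A₂ W (e :: U ++ a' :: B₂) V₁ V₂ u y x
      have d' := Desc.zero (a' :: A₁) A₂ W (U ++ e :: a' :: B₂) V₁ V₂ u y x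
      rw [List.cons_append] at d d'
      rw [d.F_eq ht, d'.F_eq hq]
      refine ih _ d.depth_lt ⟨_, B₂ ++ x :: (V₂ ++ y :: (V₁ ++ [u])), U, a', e, rfl, rfl, ?_, ?_⟩
        (d.good ht) (d'.good hq) rfl <;> simp [bot]
    · have hua : u ≠ a' := by
        rintro rfl
        have := ht.nodup
        simp [top] at this hW
        grind
      obtain ⟨W₁, W₂, rfl⟩ := List.append_of_mem hW
      simp only [List.mem_append, List.mem_cons, hua, false_or] at hB
      -- The lower row, as a word, is unchanged by this descent. Only the place where `B` is cut at
      -- `u` varies: at the moved letter, between it and `a'`, or behind `a'`.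
      rcases hB with (rfl | hB) | hB
      · have d := Desc.one (a' :: A) W₁ W₂ [] (U ++ a' :: B₂) V u y x
        have d' := Desc.one (a' :: A) W₁ W₂ U (a' :: B₂) V u y x
        rw [List.nil_append, ← List.cons_append] at d
        rw [d.F_eq ht, d'.F_eq hq]
        refine ih _ d.depth_lt ⟨_, B₂ ++ x :: (V ++ [y]), U, a', u, rfl, rfl, ?_, ?_⟩
          (d.good ht) (d'.good hq) rfl <;> simp [bot]
      · obtain ⟨P, Q, rfl⟩ := List.append_of_mem hB
        have d := Desc.one (a' :: A) W₁ W₂ (e :: P) (Q ++ a' :: B₂) V u y x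
        have d' := Desc.one (a' :: A) W₁ W₂ P (Q ++ e :: a' :: B₂) V u y x
        simp only [List.cons_append, List.append_assoc] at d d' ht hq ih ⊢
        rw [d.F_eq ht, d'.F_eq hq]
        refine ih _ d.depth_lt ⟨_, B₂ ++ x :: (V ++ [y]), P ++ u :: Q, a', e, rfl, rfl, ?_, ?_⟩
          (d.good ht) (d'.good hq) rfl <;> simp [bot]
      · obtain ⟨P, Q, rfl⟩ := List.append_of_mem hB
        have d := Desc.one (a' :: A) W₁ W₂ (e :: U ++ a' :: P) Q V u y x
        have d' := Desc.one (a' :: A) W₁ W₂ (U ++ e :: a' :: P) Q V u y x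
        simp only [List.cons_append, List.append_assoc] at d d' ht hq ih ⊢
        rw [d.F_eq ht, d'.F_eq hq]
        refine ih _ d.depth_lt ⟨_, P ++ u :: (Q ++ x :: (V ++ [y])), U, a', e, rfl, rfl, ?_, ?_⟩
          (d.good ht) (d'.good hq) rfl <;> simp [bot]
  · obtain ⟨V₁, V₂, rfl⟩ := List.append_of_mem ha
    have h5 : (B ++ x :: V₁) ++ a' :: (V₂ ++ [y]) = (e :: U) ++ a' :: D := by simpa [bot] using h3
    obtain ⟨h6, rfl⟩ := nodup_split_unique h5 (by simpa [bot] using ht.nodup_bot)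
    have d := Desc.zero [] A W B V₁ V₂ a' y x
    rw [List.nil_append] at d
    rw [d.F_eq ht]
    rcases B with _ | ⟨e', B⟩
    · obtain ⟨rfl, rfl⟩ : x = e ∧ V₁ = U := by simpa using h6
      obtain rfl := hq.eq_of_rows (q := ⟨a' :: A, y, W, x, V₁, a' :: V₂⟩) h2
        (h4.trans (by simp [bot]))
      have d' := Desc.zero [] A W V₁ [] V₂ a' y x
      rw [List.nil_append, List.nil_append] at d'
      rw [d'.F_eq hq]
      -- The moved letter is `x` itself, which bounds the segment rotated by the descent. Hence a
      -- whole block, not just one letter, has to be carried around.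
      refine F_eq_of_rotate (d.good ht) (C₁ := x :: (V₂ ++ [y])) (C₂ := V₁) ?_ ?_ <;> simp
    · obtain ⟨rfl, rfl⟩ : e' = e ∧ B ++ x :: V₁ = U := by simpa using h6
      obtain rfl := hq.eq_of_rows (q := ⟨a' :: A, y, W, x, B, V₁ ++ e' :: a' :: V₂⟩) h2
        (h4.trans (by simp [bot]))
      have d' := Desc.zero [] A W B (V₁ ++ [e']) V₂ a' y x
      rw [List.nil_append, List.append_assoc, List.singleton_append] at d'
      rw [d'.F_eq hq]
      refine F_eq_of_cons (d.good ht) (e := e') (U := B ++ x :: (V₂ ++ y :: V₁)) ?_ ?_ <;> simp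

end RauzyTab

/-! ### Pairs as words: irreducibility, moves and tableaux -/

namespace RauzyPair

open Relation

variable {A : Type*} [Fintype A]

theorem length_row (p : RauzyPair A) (ε : Fin 2) : (p.row ε).length = Fintype.card A := by
  simp [row]

theorem nodup_row (p : RauzyPair A) (ε : Fin 2) : (p.row ε).Nodup :=
  List.nodup_ofFn.2 (p ε).symm.injective

theorem mem_row (p : RauzyPair A) (ε : Fin 2) (b : A) : b ∈ p.row ε := by
  simp only [row, List.mem_ofFn]
  exact ⟨p ε b, by simp⟩

theorem pos_injective (p : RauzyPair A) (ε : Fin 2) : Function.Injective (p.pos ε) := by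
  intro b c h
  simpa [pos, Fin.val_inj] using h

theorem getElem_row (p : RauzyPair A) (ε : Fin 2) (i : ℕ) (h : i < (p.row ε).length) :
    p.pos ε (p.row ε)[i] = i + 1 := by
  simp [row, pos]

theorem pos_of_row {p : RauzyPair A} {ε : Fin 2} {L M : List A} {b : A}
    (h : p.row ε = L ++ b :: M) : p.pos ε b = L.length + 1 := by
  have hl : L.length < (p.row ε).length := by simp [h]
  rw [← p.getElem_row ε L.length hl]
  simp [h]

theorem mem_take_row (p : RauzyPair A) (ε : Fin 2) (k : ℕ) (b : A) :
    b ∈ (p.row ε).take k ↔ p.pos ε b ≤ k := by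
  rw [List.mem_take_iff_getElem]
  constructor
  · rintro ⟨i, hi, rfl⟩
    rw [getElem_row]
    omega
  · intro h
    obtain ⟨i, hi, rfl⟩ := List.getElem_of_mem (p.mem_row ε b)
    rw [getElem_row] at h
    exact ⟨i, by omega, rfl⟩

theorem eq_of_row_eq {p q : RauzyPair A} {ε : Fin 2} (h : p.row ε = q.row ε) : p ε = q ε := by
  have := List.ofFn_injective h
  have h' : (p ε).symm = (q ε).symm := Equiv.ext fun i => congrFun this i
  simpa using congrArg Equiv.symm h'

theorem one_sub_ne (ε : Fin 2) : 1 - ε ≠ ε := by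
  fin_cases ε <;> decide

theorem eq_or_eq_one_sub (ε δ : Fin 2) : δ = ε ∨ δ = 1 - ε := by
  fin_cases ε <;> fin_cases δ <;> decide

theorem ext_of_rows {p q : RauzyPair A} (ε : Fin 2) (h : p.row ε = q.row ε)
    (h' : p.row (1 - ε) = q.row (1 - ε)) : p = q := by
  funext δ
  rcases eq_or_eq_one_sub ε δ with rfl | rfl
  · exact eq_of_row_eq h
  · exact eq_of_row_eq h'

theorem exists_equiv_ofFn {u : List A} (hu : u.Nodup) (hm : ∀ a, a ∈ u) :
    ∃ e : A ≃ Fin (Fintype.card A), (List.ofFn fun i => e.symm i) = u := by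
  classical
  have hl : u.length = Fintype.card A := by
    rw [← Fintype.card_fin u.length]
    exact Fintype.card_congr (hu.getEquivOfForallMemList u hm)
  refine ⟨((finCongr hl.symm).trans (hu.getEquivOfForallMemList u hm)).symm, ?_⟩
  apply List.ext_getElem <;> simp [hl]

theorem exists_of_rows (ε : Fin 2) {u v : List A} (hu : u.Nodup) (hv : v.Nodup)
    (hmu : ∀ a, a ∈ u) (hmv : ∀ a, a ∈ v) :
    ∃ p : RauzyPair A, p.row ε = u ∧ p.row (1 - ε) = v := by
  obtain ⟨e, he⟩ := exists_equiv_ofFn hu hmu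
  obtain ⟨f, hf⟩ := exists_equiv_ofFn hv hmv
  refine ⟨fun δ => if δ = ε then e else f, ?_, ?_⟩
  · simpa [row] using he
  · simpa [row, one_sub_ne] using hf

/-- A pair with one given row, the other row being a rearrangement of a row of `p`. -/
theorem exists_of_perm (p : RauzyPair A) (ε : Fin 2) {v : List A}
    (hv : v.Perm (p.row (1 - ε))) :
    ∃ q : RauzyPair A, q.row ε = p.row ε ∧ q.row (1 - ε) = v :=
  exists_of_rows ε (p.nodup_row ε) (hv.nodup_iff.2 (p.nodup_row _)) (p.mem_row ε)
    fun a => hv.mem_iff.2 (p.mem_row _ a)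

theorem perm_rows (p : RauzyPair A) (ε δ : Fin 2) : (p.row ε).Perm (p.row δ) :=
  (List.perm_ext_iff_of_nodup (p.nodup_row ε) (p.nodup_row δ)).2 fun a => by simp [mem_row]

theorem isIrreducible_iff {p : RauzyPair A} (ε : Fin 2) :
    p.IsIrreducible ↔ ∀ k, 0 < k → k < Fintype.card A →
      ¬ ((p.row ε).take k).Perm ((p.row (1 - ε)).take k) := by
  have key : ∀ k, {b : A | p.pos 0 b ≤ k} = {b : A | p.pos 1 b ≤ k} ↔
      ((p.row ε).take k).Perm ((p.row (1 - ε)).take k) := by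
    intro k
    rw [List.perm_ext_iff_of_nodup ((p.nodup_row _).sublist (List.take_sublist ..))
      ((p.nodup_row _).sublist (List.take_sublist ..)), Set.ext_iff]
    simp only [mem_take_row, Set.mem_ofPred_eq]
    fin_cases ε
    · rfl
    · exact forall_congr' fun b => Iff.comm
  constructor
  · intro h k h0 hk hp
    exact hk.ne ((h k h0 hk.le).1 ((key k).2 hp))
  · intro h k h0 hk
    refine ⟨fun hs => ?_, fun hs => ?_⟩
    · by_contra hne
      exact h k h0 (lt_of_le_of_ne hk hne) ((key k).1 hs)
    · rw [key, hs, List.take_of_length_le (p.length_row _).le,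
        List.take_of_length_le (p.length_row _).le]
      exact p.perm_rows _ _

theorem rauzyMove_of_rows {p q : RauzyPair A} {ε : Fin 2} {C D U : List A} {x e : A}
    (h1 : p.row ε = C ++ [x]) (h2 : q.row ε = p.row ε) (h3 : p.row (1 - ε) = D ++ x :: (U ++ [e]))
    (h4 : q.row (1 - ε) = D ++ x :: e :: U) : RauzyMove ε p q := by
  refine ⟨eq_of_row_eq h2, fun z hz b => ?_⟩
  have hC : Fintype.card A = C.length + 1 := by rw [← p.length_row ε, h1]; simp
  have hD : Fintype.card A = D.length + U.length + 2 := by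
    rw [← p.length_row (1 - ε), h3]; simp; omega
  obtain rfl : z = x := p.pos_injective ε (by rw [hz, pos_of_row h1, hC])
  have hb := p.mem_row (1 - ε) b
  rw [h3] at hb
  rw [pos_of_row h3]
  simp only [List.mem_append, List.mem_cons, List.not_mem_nil, or_false] at hb
  rcases hb with hb | rfl | hb | rfl
  · obtain ⟨P, Q, rfl⟩ := List.append_of_mem hb
    rw [pos_of_row (L := P) (M := Q ++ z :: (U ++ [e])) (h3.trans (by simp)),
      pos_of_row (L := P) (M := Q ++ z :: e :: U) (h4.trans (by simp))]
    simp
  · rw [pos_of_row h3, pos_of_row h4]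
    simp
  · obtain ⟨P, Q, rfl⟩ := List.append_of_mem hb
    rw [pos_of_row (L := D ++ z :: P) (M := Q ++ [e]) (h3.trans (by simp)),
      pos_of_row (L := D ++ z :: e :: P) (M := Q) (h4.trans (by simp))]
    simp at hD ⊢
    split_ifs <;> omega
  · rw [pos_of_row (L := D ++ z :: U) (M := []) (h3.trans (by simp)),
      pos_of_row (L := D ++ [z]) (M := U) (h4.trans (by simp))]
    simp
    omega

theorem leftRauzyMove_of_rows {p q : RauzyPair A} {ε : Fin 2} {C D U : List A} {a e : A}
    (h1 : p.row ε = a :: C) (h2 : q.row ε = p.row ε) (h3 : p.row (1 - ε) = e :: (U ++ a :: D))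
    (h4 : q.row (1 - ε) = U ++ e :: a :: D) : LeftRauzyMove ε p q := by
  refine ⟨eq_of_row_eq h2, fun z hz b => ?_⟩
  obtain rfl : z = a := p.pos_injective ε (by rw [hz, pos_of_row (L := []) h1]; rfl)
  have hb := p.mem_row (1 - ε) b
  rw [h3] at hb
  rw [pos_of_row (L := e :: U) h3]
  simp only [List.mem_append, List.mem_cons] at hb
  rcases hb with rfl | hb | rfl | hb
  · rw [pos_of_row (L := []) h3, pos_of_row h4]
    simp
  · obtain ⟨P, Q, rfl⟩ := List.append_of_mem hb
    rw [pos_of_row (L := e :: P) (M := Q ++ z :: D) (h3.trans (by simp)),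
      pos_of_row (L := P) (M := Q ++ e :: z :: D) (h4.trans (by simp))]
    simp
  · rw [pos_of_row (L := e :: U) h3, pos_of_row (L := U ++ [e]) (M := D) (h4.trans (by simp))]
    simp
  · obtain ⟨P, Q, rfl⟩ := List.append_of_mem hb
    rw [pos_of_row (L := e :: (U ++ z :: P)) (M := Q) (h3.trans (by simp)),
      pos_of_row (L := U ++ e :: z :: P) (M := Q) (h4.trans (by simp))]
    simp
    omega

theorem ext_of_pos {p q : RauzyPair A} (ε : Fin 2) (h : p ε = q ε)
    (h' : ∀ b, p.pos (1 - ε) b = q.pos (1 - ε) b) : p = q := by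
  funext δ
  rcases eq_or_eq_one_sub ε δ with rfl | rfl
  · exact h
  · ext b
    simpa [pos] using h' b

theorem exists_pos_eq (p : RauzyPair A) (ε : Fin 2) {k : ℕ} (h0 : 0 < k)
    (hk : k ≤ Fintype.card A) : ∃ z, p.pos ε z = k :=
  ⟨(p.row ε)[k - 1]'(by rw [length_row]; omega), by rw [getElem_row]; omega⟩

theorem RauzyMove.unique {p q r : RauzyPair A} {ε : Fin 2} (h : RauzyMove ε p q)
    (h' : RauzyMove ε p r) : q = r := by
  refine ext_of_pos ε (h.1.trans h'.1.symm) fun b => ?_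
  obtain ⟨z, hz⟩ := p.exists_pos_eq ε (Fintype.card_pos_iff.2 ⟨b⟩) le_rfl
  rw [h.2 z hz, h'.2 z hz]

theorem LeftRauzyMove.unique {p q r : RauzyPair A} {ε : Fin 2} (h : LeftRauzyMove ε p q)
    (h' : LeftRauzyMove ε p r) : q = r := by
  refine ext_of_pos ε (h.1.trans h'.1.symm) fun b => ?_
  obtain ⟨z, hz⟩ := p.exists_pos_eq ε one_pos (Fintype.card_pos_iff.2 ⟨b⟩)
  rw [h.2 z hz, h'.2 z hz]

/-- The rows of `p` are those of `t`. -/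
def HasTab (p : RauzyPair A) (t : RauzyTab A) : Prop := t.top = p.row 0 ∧ t.bot = p.row 1

theorem IsIrreducible.exists_tab {p : RauzyPair A} (hp : p.IsIrreducible)
    (hn : 2 ≤ Fintype.card A) : ∃ t : RauzyTab A, t.Good ∧ p.HasTab t := by
  have hl0 := p.length_row 0
  have hl1 := p.length_row 1
  have hirr := (isIrreducible_iff 0).1 hp
  simp only [sub_zero] at hirr
  rcases List.eq_nil_or_concat' (p.row 0) with h0 | ⟨C, x, h0⟩
  · simp [h0] at hl0; omega
  rcases List.eq_nil_or_concat' (p.row 1) with h1 | ⟨D, y, h1⟩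
  · simp [h1] at hl1; omega
  have hC : C.length + 1 = Fintype.card A := by rw [← hl0, h0]; simp
  have hD : D.length + 1 = Fintype.card A := by rw [← hl1, h1]; simp
  -- With equal last letters, the prefixes of length `#A - 1` would have the same letters; this
  -- length is positive because there are two letters.
  have hxy : x ≠ y := by
    rintro rfl
    refine hirr C.length (by omega) (by omega) ?_
    have hp := p.perm_rows 0 1
    rw [h0, h1] at hp ⊢
    rw [List.take_left' rfl, List.take_left' (by omega)]
    exact (List.perm_append_right_iff [x]).1 hp
  have hy : y ∈ C := by
    have := p.mem_row 0 y
    rw [h0] at this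
    simpa [hxy.symm] using this
  have hx : x ∈ D := by
    have := p.mem_row 1 x
    rw [h1] at this
    simpa [hxy] using this
  obtain ⟨A₀, W, rfl⟩ := List.append_of_mem hy
  obtain ⟨B, V, rfl⟩ := List.append_of_mem hx
  have ht : p.HasTab ⟨A₀, y, W, x, B, V⟩ := by
    constructor <;> simp [RauzyTab.top, RauzyTab.bot, h0, h1]
  refine ⟨_, ⟨ht.1 ▸ p.nodup_row 0, ?_, ?_⟩, ht⟩
  · rw [ht.1, ht.2]; exact p.perm_rows 0 1
  · intro k hk0 hkA hkB hk
    refine hirr k hk0 (by simp at hkA hC; omega) ?_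
    rw [← ht.1, ← ht.2, RauzyTab.top, RauzyTab.bot, List.take_append_of_le_length hkA,
      List.take_append_of_le_length hkB]
    exact hk

/-- Every nonempty prefix of one row contains `a`, and no proper prefix of the other does. -/
theorem isIrreducible_of_half {p : RauzyPair A} {ε : Fin 2} {C D : List A} {a : A}
    (h : p.row ε = a :: C) (h' : p.row (1 - ε) = D ++ [a]) : p.IsIrreducible := by
  refine (isIrreducible_iff ε).2 fun k h0 hk hp => ?_
  have hl := p.length_row (1 - ε)
  have hn := p.nodup_row (1 - ε)
  rw [h'] at hl hn
  rw [h, h', List.take_append_of_le_length (by simp at hl; omega)] at hp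
  have ha : a ∈ (a :: C).take k := by
    obtain ⟨k, rfl⟩ := Nat.exists_eq_succ_of_ne_zero h0.ne'
    simp
  exact (List.nodup_append.1 hn).2.2 a (List.mem_of_mem_take (hp.mem_iff.1 ha)) a (by simp) rfl

theorem HasTab.isStandard {p : RauzyPair A} {t : RauzyTab A} (h : p.HasTab t) (ht : t.Std) :
    p.IsStandard := by
  obtain ⟨A₀, y, W, x, B, V⟩ := t
  obtain ⟨rfl, rfl⟩ := ht
  obtain ⟨h0, h1⟩ := h
  simp only [RauzyTab.top, RauzyTab.bot, List.nil_append] at h0 h1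
  have l0 := p.length_row 0
  have l1 := p.length_row 1
  rw [← h0] at l0
  rw [← h1] at l1
  simp only [List.length_cons, List.length_append, List.length_nil] at l0 l1
  have p1 : p.pos 0 y = 1 := pos_of_row (L := []) h0.symm
  have p2 : p.pos 0 x = Fintype.card A :=
    (pos_of_row (L := y :: W) (M := []) h0.symm).trans (by simpa using l0)
  have p3 : p.pos 1 x = 1 := pos_of_row (L := []) h1.symm
  have p4 : p.pos 1 y = Fintype.card A :=
    (pos_of_row (L := x :: V) (M := []) h1.symm).trans (by simpa using l1)
  refine ⟨isIrreducible_of_half (ε := 0) h0.symm (D := x :: V) h1.symm, fun b => ?_⟩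
  have key : ∀ {ε : Fin 2} {c : A} {k : ℕ}, p.pos ε c = k → (p.pos ε b = k ↔ b = c) := by
    rintro ε c k rfl
    exact (p.pos_injective ε).eq_iff
  rw [key p1, key p2, key p3, key p4]
  exact ⟨Iff.rfl, Iff.rfl⟩

theorem IsStandard.std {p : RauzyPair A} {t : RauzyTab A} (hp : p.IsStandard) (h : p.HasTab t) :
    t.Std := by
  obtain ⟨A₀, y, W, x, B, V⟩ := t
  obtain ⟨h0, h1⟩ := h
  simp only [RauzyTab.top, RauzyTab.bot] at h0 h1
  have l0 := p.length_row 0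
  have l1 := p.length_row 1
  rw [← h0] at l0
  rw [← h1] at l1
  simp only [List.length_cons, List.length_append, List.length_nil] at l0 l1
  have p1 := pos_of_row h0.symm
  have p2 := pos_of_row (b := x) (L := A₀ ++ y :: W) (M := []) (h0.symm.trans (by simp))
  have p3 := pos_of_row h1.symm
  have p4 := pos_of_row (b := y) (L := B ++ x :: V) (M := []) (h1.symm.trans (by simp))
  have hx := (hp.2 x).2.2 (by rw [p2]; simp; omega)
  have hy := (hp.2 y).1.2 (by rw [p4]; simp; omega)
  constructor
  · rw [← List.length_eq_zero_iff]; simp only; omega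
  · rw [← List.length_eq_zero_iff]; simp only; omega

/-- The position formula determines the image, so it suffices to build a pair with the expected rows
and check that it is an image. -/
theorem RauzyMove.rows {p q : RauzyPair A} {ε : Fin 2} (h : RauzyMove ε p q) {C D U : List A}
    {x e : A} (h1 : p.row ε = C ++ [x]) (h3 : p.row (1 - ε) = D ++ x :: (U ++ [e])) :
    q.row ε = p.row ε ∧ q.row (1 - ε) = D ++ x :: e :: U := by
  obtain ⟨r, h2, h4⟩ := p.exists_of_perm ε (v := D ++ x :: e :: U) (by
    rw [h3]
    exact (List.Perm.cons x (List.perm_append_singleton e U).symm).append_left D)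
  obtain rfl := h.unique (rauzyMove_of_rows h1 h2 h3 h4)
  exact ⟨h2, h4⟩

theorem LeftRauzyMove.rows {p q : RauzyPair A} {ε : Fin 2} (h : LeftRauzyMove ε p q)
    {C D U : List A} {a e : A} (h1 : p.row ε = a :: C) (h3 : p.row (1 - ε) = e :: (U ++ a :: D)) :
    q.row ε = p.row ε ∧ q.row (1 - ε) = U ++ e :: a :: D := by
  obtain ⟨r, h2, h4⟩ := p.exists_of_perm ε (v := U ++ e :: a :: D) (by
    rw [h3]
    exact List.perm_middle)
  obtain rfl := h.unique (leftRauzyMove_of_rows h1 h2 h3 h4)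
  exact ⟨h2, h4⟩

/-! ### The invariant on extended Rauzy classes -/

theorem F_eq_of_step {p q : RauzyPair A} {ε : Fin 2} (hn : 2 ≤ Fintype.card A)
    (h : RauzyMove ε p q ∨ LeftRauzyMove ε p q) (hp : p.IsIrreducible) {t s : RauzyTab A}
    (ht : t.Good) (hs : s.Good) (hpt : t.top = p.row ε ∧ t.bot = p.row (1 - ε))
    (hqs : s.top = q.row ε ∧ s.bot = q.row (1 - ε)) : t.F = s.F := by
  obtain ⟨h0, h1⟩ := hpt
  rcases h with h | h
  · obtain ⟨U, e, hU⟩ : ∃ U e, t.V ++ [t.y] = U ++ [e] := ⟨_, _, rfl⟩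
    have h3 : t.bot = t.B ++ t.x :: (t.V ++ [t.y]) := rfl
    have h2 : t.top = (t.A ++ t.y :: t.W) ++ [t.x] := by simp [RauzyTab.top]
    obtain ⟨h4, h5⟩ := h.rows (h0 ▸ h2) (h1 ▸ h3)
    exact RauzyTab.RightMove.F_eq
      ⟨_, _, _, _, _, h2, hqs.1.trans (h4.trans h0.symm), h3, hqs.2.trans h5⟩ ht hs
  · obtain ⟨a, C, h2⟩ : ∃ a C, t.top = a :: C := List.exists_cons_of_ne_nil (by simp [RauzyTab.top])
    obtain ⟨U, D, e, h3⟩ : ∃ U D e, t.bot = e :: (U ++ a :: D) := by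
      obtain ⟨L, D, h3⟩ := List.append_of_mem (ht.perm.mem_iff.1 (h2 ▸ List.mem_cons_self) :
        a ∈ t.bot)
      rcases L with _ | ⟨e, U⟩
      -- Irreducibility at `k = 1` excludes a common first letter of the two rows.
      · refine absurd ?_ ((isIrreducible_iff ε).1 hp 1 one_pos (by omega))
        rw [← h0, ← h1, h2, h3]
        simp
      · exact ⟨U, D, e, h3⟩
    obtain ⟨h4, h5⟩ := h.rows (h0 ▸ h2) (h1 ▸ h3)
    exact RauzyTab.LeftMove.F_eq
      ⟨_, _, _, _, _, h2, hqs.1.trans (h4.trans h0.symm), h3, hqs.2.trans h5⟩ ht hs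

theorem ExtendedRauzyStep.F_eq {p q : RauzyPair A} (hn : 2 ≤ Fintype.card A)
    (h : ExtendedRauzyStep p q) {t s : RauzyTab A}
    (ht : t.Good) (hs : s.Good) (hpt : p.HasTab t) (hqs : q.HasTab s) : t.F = s.F := by
  obtain ⟨hp, hq, ε, h⟩ := h
  rcases eq_or_eq_one_sub 0 ε with rfl | rfl
  · exact F_eq_of_step hn h hp ht hs hpt hqs
  · exact RauzyTab.F_swap_inj.1
      (F_eq_of_step hn h hp ht.swap hs.swap ⟨hpt.2, hpt.1⟩ ⟨hqs.2, hqs.1⟩)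

/-- The switch classes of standard rows to which the irreducible pair `p` descends. -/
def switchClass (p : RauzyPair A) : Set (RauzyTab A) :=
  {s | ∃ t : RauzyTab A, t.Good ∧ p.HasTab t ∧ s ∈ t.F}

theorem HasTab.switchClass_eq {p : RauzyPair A} {t : RauzyTab A} (h : p.HasTab t) (ht : t.Good) :
    p.switchClass = t.F := by
  ext s
  constructor
  · rintro ⟨t', ht', h', hs⟩
    rwa [ht.eq_of_rows (h.1.trans h'.1.symm) (h.2.trans h'.2.symm)]
  · exact fun hs => ⟨t, ht, h, hs⟩

theorem switchClass_eq_of_eqvGen {p q : RauzyPair A} (hn : 2 ≤ Fintype.card A)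
    (h : EqvGen ExtendedRauzyStep p q) : p.switchClass = q.switchClass := by
  induction h with
  | rel p q h =>
    obtain ⟨t, ht, hpt⟩ := h.1.exists_tab hn
    obtain ⟨s, hs, hqs⟩ := h.2.1.exists_tab hn
    rw [hpt.switchClass_eq ht, hqs.switchClass_eq hs]
    exact h.F_eq hn ht hs hpt hqs
  | refl => rfl
  | symm _ _ _ ih => exact ih.symm
  | trans _ _ _ _ _ ih ih' => exact ih.trans ih'

theorem HasTab.ext {p q : RauzyPair A} {t : RauzyTab A} (h : p.HasTab t) (h' : q.HasTab t) :
    p = q :=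
  ext_of_rows 0 (h.1.symm.trans h'.1) (h.2.symm.trans h'.2)

/-! ### Transfer of switches from tableaux to pairs -/

theorem HasTab.exists_switchMove {p : RauzyPair A} {t s : RauzyTab A} (hp : p.HasTab t)
    (h : t.Switch s) : ∃ q : RauzyPair A, q.HasTab s ∧ SwitchMove p q := by
  classical
  have hst : p.IsStandard := hp.isStandard (by cases h <;> exact ⟨rfl, rfl⟩)
  have hperm : s.top.Perm t.top ∧ s.bot.Perm t.bot := by
    cases h <;> constructor <;> simp only [RauzyTab.top, RauzyTab.bot, List.perm_iff_count,
      List.count_append, List.count_cons, List.count_nil] <;> intro a <;> omega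
  rw [hp.1, hp.2] at hperm
  obtain ⟨q, h0, h1⟩ := exists_of_rows 0 (hperm.1.nodup_iff.2 (p.nodup_row 0))
    (hperm.2.nodup_iff.2 (p.nodup_row 1)) (fun a => hperm.1.mem_iff.2 (p.mem_row 0 a))
    (fun a => hperm.2.mem_iff.2 (p.mem_row 1 a))
  simp only [sub_zero] at h1
  refine ⟨q, ⟨h0.symm, h1.symm⟩, ?_⟩
  obtain ⟨p0, p1⟩ := hp
  cases h with
  | inner W₁ W₂ W₃ W₄ W₅ W₆ a b c z =>
    refine ⟨b, c, .inl ⟨hst, a, z, W₁, W₂, W₃, W₄, W₅, W₆, ?_⟩⟩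
    rw [← p0, ← p1, h0, h1]
    simp [RauzyTab.top, RauzyTab.bot]
  | first W₁ W₂ W₃ W₄ a b z =>
    refine ⟨a, b, .inr (.inl ⟨hst, z, W₁, W₂, W₃, W₄, ?_⟩)⟩
    rw [← p0, ← p1, h0, h1]
    simp [RauzyTab.top, RauzyTab.bot]
  | last W₁ W₂ W₃ W₄ a b z =>
    refine ⟨b, z, .inr (.inr ⟨hst, a, W₁, W₂, W₃, W₄, ?_⟩)⟩
    rw [← p0, ← p1, h0, h1]
    simp [RauzyTab.top, RauzyTab.bot]

theorem HasTab.reflTransGen_switchMove {p q : RauzyPair A} {t s : RauzyTab A} (hp : p.HasTab t)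
    (hq : q.HasTab s) (h : ReflTransGen RauzyTab.Switch t s) : ReflTransGen SwitchMove p q := by
  induction h generalizing q with
  | refl => rw [hp.ext hq]
  | tail _ h ih =>
    -- The inverse switch, applied to `q`, serves to produce a pair carrying the intermediate
    -- tableau.
    obtain ⟨r, hr, hqr⟩ := hq.exists_switchMove h.symm
    obtain ⟨q', hq', h'⟩ := hr.exists_switchMove h
    obtain rfl := hq.ext hq'
    exact (ih hr).tail h'

/-! ### Switch moves as products of rotations -/

/-- Prefixes up to the length of `D` are those of `p`. A longer one contains `x`, which the other
row has only at its end. -/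
theorem isIrreducible_of_rotate {p q : RauzyPair A} {ε : Fin 2} {C D U U' : List A} {x : A}
    (hp : p.IsIrreducible) (h1 : p.row ε = C ++ [x]) (h2 : q.row ε = p.row ε)
    (h3 : p.row (1 - ε) = D ++ x :: U) (h4 : q.row (1 - ε) = D ++ x :: U') :
    q.IsIrreducible := by
  refine (isIrreducible_iff ε).2 fun k h0 hk hperm => ?_
  have hl := p.length_row ε
  have hn := p.nodup_row ε
  rw [h2, h4] at hperm
  by_cases hkD : k ≤ D.length
  · refine (isIrreducible_iff ε).1 hp k h0 hk ?_
    rwa [h3, List.take_append_of_le_length hkD, ← List.take_append_of_le_length hkD]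
  · rw [h1] at hl hn hperm
    rw [List.take_append_of_le_length (by simp at hl; omega)] at hperm
    refine (List.nodup_append.1 hn).2.2 x (List.mem_of_mem_take (hperm.mem_iff.2 ?_)) x (by simp) rfl
    rw [← q.length_row (1 - ε)] at hk
    rw [← h4, mem_take_row, pos_of_row h4]
    omega

theorem exists_right_rotation {p : RauzyPair A} {ε : Fin 2} {C D : List A} {x : A}
    (U V : List A) (hp : p.IsIrreducible) (h1 : p.row ε = C ++ [x])
    (h3 : p.row (1 - ε) = D ++ x :: (U ++ V)) :
    ∃ q : RauzyPair A, q.IsIrreducible ∧ q.row ε = p.row ε ∧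
      q.row (1 - ε) = D ++ x :: (V ++ U) ∧ EqvGen ExtendedRauzyStep p q := by
  induction V using List.reverseRecOn generalizing p U with
  | nil => exact ⟨p, hp, rfl, by simpa using h3, .refl p⟩
  | append_singleton V e ih =>
    obtain ⟨q, h2, h4⟩ := p.exists_of_perm ε (v := D ++ x :: e :: (U ++ V)) (by
      rw [h3, ← List.append_assoc]
      exact (List.Perm.cons x (List.perm_append_singleton e (U ++ V)).symm).append_left D)
    have h3' : p.row (1 - ε) = D ++ x :: ((U ++ V) ++ [e]) := by simpa using h3
    have hq := isIrreducible_of_rotate hp h1 h2 h3 h4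
    obtain ⟨r, hr, h5, h6, h7⟩ := ih (e :: U) hq (h2.trans h1) (by simpa using h4)
    exact ⟨r, hr, h5.trans h2, by simpa using h6,
      .trans _ _ _ (.rel _ _ ⟨hp, hq, ε, .inl (rauzyMove_of_rows h1 h2 h3' h4)⟩) h7⟩

/-- The letter `a` stays first in one row and last in the other, so `isIrreducible_of_half` covers
all intermediate pairs. -/
theorem exists_left_rotation {p : RauzyPair A} {ε : Fin 2} {C : List A} {a : A}
    (U V : List A) (h1 : p.row ε = a :: C) (h3 : p.row (1 - ε) = U ++ V ++ [a]) :
    ∃ q : RauzyPair A, q.IsIrreducible ∧ q.row ε = p.row ε ∧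
      q.row (1 - ε) = V ++ U ++ [a] ∧ EqvGen ExtendedRauzyStep p q := by
  induction U generalizing p V with
  | nil => exact ⟨p, isIrreducible_of_half h1 h3, rfl, by simpa using h3, .refl p⟩
  | cons e U ih =>
    obtain ⟨q, h2, h4⟩ := p.exists_of_perm ε (v := (U ++ V) ++ e :: a :: []) (by
      rw [h3]
      simpa using (List.perm_middle (l₁ := U ++ V) (l₂ := [a]) (a := e)))
    have h4' : q.row (1 - ε) = U ++ (V ++ [e]) ++ [a] := by simpa using h4
    obtain ⟨r, hr, h5, h6, h7⟩ := ih (V ++ [e]) (h2.trans h1) h4'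
    exact ⟨r, hr, h5.trans h2, by simpa using h6,
      .trans _ _ _ (.rel _ _ ⟨isIrreducible_of_half h1 h3,
        isIrreducible_of_half (h2.trans h1) h4', ε,
        .inr (leftRauzyMove_of_rows h1 h2 (by simpa using h3) h4)⟩) h7⟩

theorem SwitchMove.eqvGen {p q : RauzyPair A} (h : SwitchMove p q) :
    EqvGen ExtendedRauzyStep p q := by
  obtain ⟨b, c, h⟩ := h
  rcases h with ⟨hp, a, z, w₁, w₂, w₃, w₄, w₅, w₆, p0, p1, q0, q1⟩ |
    ⟨hp, z, w₁, w₂, w₃, w₄, p0, p1, q0, q1⟩ | ⟨hp, a, w₁, w₂, w₃, w₄, p0, p1, q0, q1⟩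
  -- Right rotations of types 1, 0, 1, 0 make `b`, then `c`, the last letters of the upper and lower
  -- rows, and then restore `z` and `a`.
  · obtain ⟨r, hr, r1, r0, er⟩ := exists_right_rotation (p := p) (ε := 1) (D := []) (x := a)
      (w₁ ++ [b]) (w₂ ++ c :: (w₃ ++ [z])) hp.1 p1 (p0.trans (by simp))
    obtain ⟨s, hs, s0, s1, es⟩ := exists_right_rotation (p := r) (ε := 0)
      (C := a :: (w₂ ++ c :: (w₃ ++ z :: w₁))) (D := z :: w₄) (x := b)
      (w₅ ++ [c]) (w₆ ++ [a]) hr (r0.trans (by simp)) ((r1.trans p1).trans (by simp))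
    obtain ⟨t, ht, t1, t0, et⟩ := exists_right_rotation (p := s) (ε := 1)
      (C := z :: (w₄ ++ b :: (w₆ ++ a :: w₅))) (D := a :: w₂) (x := c)
      (w₃ ++ [z]) (w₁ ++ [b]) hs (s1.trans (by simp)) ((s0.trans r0).trans (by simp))
    obtain ⟨u, hu, u0, u1, eu⟩ := exists_right_rotation (p := t) (ε := 0)
      (C := a :: (w₂ ++ c :: (w₁ ++ b :: w₃))) (D := []) (x := z)
      (w₄ ++ b :: (w₆ ++ [a])) (w₅ ++ [c]) ht (t0.trans (by simp))
      ((t1.trans s1).trans (by simp))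
    obtain rfl : u = q := ext_of_rows 0 ((u0.trans t0).trans (by simp [q0]))
      (u1.trans (by simp [q1]))
    exact .trans _ _ _ er (.trans _ _ _ es (.trans _ _ _ et eu))
  · obtain ⟨r, hr, r1, r0, er⟩ := exists_left_rotation (p := p) (ε := 1) (a := z)
      (b :: w₁) (c :: w₂) (p1.trans (by simp; rfl)) (p0.trans (by simp))
    obtain ⟨s, hs, s0, s1, es⟩ := exists_right_rotation (p := r) (ε := 0)
      (C := c :: (w₂ ++ b :: w₁)) (D := []) (x := z)
      (w₃ ++ [c]) (w₄ ++ [b]) hr (r0.trans (by simp)) ((r1.trans p1).trans (by simp))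
    obtain rfl : s = q := ext_of_rows 0 ((s0.trans r0).trans (by simp [q0]))
      (s1.trans (by simp [q1]))
    exact .trans _ _ _ er es
  · obtain ⟨r, hr, r1, r0, er⟩ := exists_right_rotation (p := p) (ε := 1) (D := []) (x := a)
      (w₁ ++ [b]) (w₂ ++ [c]) hp.1 p1 (p0.trans (by simp))
    obtain ⟨s, hs, s0, s1, es⟩ := exists_left_rotation (p := r) (ε := 0) (a := a)
      (c :: w₃) (b :: w₄) r0 ((r1.trans p1).trans (by simp))
    obtain rfl : s = q := ext_of_rows 0 ((s0.trans r0).trans (by simp [q0]))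
      (s1.trans (by simp [q1]))
    exact .trans _ _ _ er es

theorem card_of_ne {p r : RauzyPair A} (h : p ≠ r) : 2 ≤ Fintype.card A := by
  by_contra hn
  have : Subsingleton A := Fintype.card_le_one_iff_subsingleton.1 (by omega)
  exact h (funext fun ε => Equiv.ext fun b => by
    have : Subsingleton (Fin (Fintype.card A)) := (p 0).symm.subsingleton
    exact Subsingleton.elim _ _)

end RauzyPair

theorem mainTheorem7 {A : Type*} [Fintype A] (p r : RauzyPair A)
    (hp : p.IsStandard) (hr : r.IsStandard) (hpr : p ≠ r) :
    RauzyPair.extendedRauzyClass p = RauzyPair.extendedRauzyClass r ↔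
      Relation.ReflTransGen RauzyPair.SwitchMove p r := by
  constructor
  · intro h
    have hn := RauzyPair.card_of_ne hpr
    have hpr' : r ∈ RauzyPair.extendedRauzyClass p := by
      rw [h]
      exact .refl r
    obtain ⟨t, ht, hpt⟩ := hp.1.exists_tab hn
    obtain ⟨s, hs, hrs⟩ := hr.1.exists_tab hn
    have hF := RauzyPair.switchClass_eq_of_eqvGen hn hpr'
    rw [hpt.switchClass_eq ht, hrs.switchClass_eq hs] at hF
    refine hpt.reflTransGen_switchMove hrs ((hp.std hpt).mem_F.1 ?_)
    rw [hF]
    exact (hr.std hrs).mem_F.2 .refl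
  · intro h
    have he : Relation.EqvGen RauzyPair.ExtendedRauzyStep p r := by
      clear hr hpr
      induction h with
      | refl => exact .refl _
      | tail _ h ih => exact .trans _ _ _ ih h.eqvGen
    ext q
    exact ⟨fun hq => .trans _ _ _ (.symm _ _ he) hq, fun hq => .trans _ _ _ he hq⟩
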